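/- Let $K\colon\mathcal X\times\mathcal X\to\mathbb R$ be a positive semidefinite kernel, $x_1,\dots,x_m\in\mathcal X$ source points with labels $y_1,\dots,y_m\in\mathbb R$ and nonnegative weights $q_1,\dots,q_m$ (for instance $q_i=\mathsf q_{\min}(x_i)$ for a distribution $\mathsf q_{\min}$ over the source sample that minimizes the discrepancy to the empirical target distribution), let $x'_1,\dots,x'_n\in\mathcal X$ be target points, $\lambda\ge 0$ and $r\in\mathbb R$. Put $\mathbf K_t^{ij}=n^{-1}K(x'_i,x'_j)$, $\mathbf K_s^{ij}=q_i^{1/2}q_j^{1/2}K(x_i,x_j)$, $\mathbf K_{st}^{ij}=n^{-1/2}q_j^{1/2}K(x'_i,x_j)$, $\mathbf y=(q_1^{1/2}y_1,\dots,q_m^{1/2}y_m)$, $\mathcal H=\{\mathbf a\in\mathbb R^m:\|\mathbf K_s\mathbf a-\mathbf y\|^2\le r^2\}$ and $\widetilde{\mathbf K}=\mathbf K_{st}^\top\mathbf K_t(\lambda\mathbf K_t+\mathbf K_t^2)^\dagger\mathbf K_t\mathbf K_{st}$, where $\dagger$ is the Moore–Penrose pseudo-inverse, and assume that $\mathcal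 H\neq\emptyset$. Then the problem $$\min_{\mathbf b\in\mathbb R^n}\ \lambda\mathbf b^\top\mathbf K_t\mathbf b+\tfrac12\Big(\max_{\mathbf a\in\mathcal H}\|\mathbf K_{st}\mathbf a-\mathbf K_t\mathbf b\|^2+\min_{\mathbf a\in\mathcal H}\|\mathbf K_{st}\mathbf a-\mathbf K_t\mathbf b\|^2\Big)\qquad(1)$$ is equivalent to the semidefinite program $$\sup_{\alpha,\beta,\nu\in\mathbb R,\ \mathbf Z\in\mathbb R^{m\times m},\ \mathbf z\in\mathbb R^m}\ \tfrac12\operatorname{Tr}(\mathbf K_{st}^\top\mathbf K_{st}\mathbf Z)-\beta-\alpha\qquad(2)$$ subject to $$\begin{pmatrix}\nu\mathbf K_s^2+\frac12\mathbf K_{st}^\top\mathbf K_{st}-\frac14\widetilde{\mathbf K}&\nu\mathbf K_s\mathbf y+\frac14\widetilde{\mathbf K}\mathbf z\\ \nu\mathbf y^\top\mathbf K_s+\frac14\mathbf z^\top\widetilde{\mathbf K}&\alpha+\nu(\|\mathbf y\|^2-r^2)\end{pmatrix}\succeq0,\qquad\begin{pmatrix}\mathbf Z&\mathbf z\\ \mathbf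 z^\top&1\end{pmatrix}\succeq0,$$ $$\begin{pmatrix}\lambda\mathbf K_t+\mathbf K_t^2&\frac12\mathbf K_t\mathbf K_{st}\mathbf z\\ \frac12\mathbf z^\top\mathbf K_{st}^\top\mathbf K_t&\beta\end{pmatrix}\succeq0,\qquad\operatorname{Tr}(\mathbf K_s^2\mathbf Z)-2\mathbf y^\top\mathbf K_s\mathbf z+\|\mathbf y\|^2\le r^2,\qquad\nu\ge0,$$ in the following sense. The inner maximum and minimum and the outer minimum in (1) are attained, and the optimal values of (1) and (2) are equal. If some $\mathbf a\in\mathbb R^m$ satisfies $\|\mathbf K_s\mathbf a-\mathbf y\|^2<r^2$, then the supremum in (2) is attained. Whenever $(\alpha,\beta,\nu,\mathbf Z,\mathbf z)$ is an optimal solution of (2), the vector $\mathbf b=\frac12(\lambda\mathbf K_t+\mathbf K_t^2)^\dagger\mathbf K_t\mathbf K_{st}(\mathbf a+\mathbf z)$ with $\mathbf a=(\nu\mathbf K_s^2+\frac12\mathbf K_{st}^\top\mathbf K_{st}-\frac14\widetilde{\mathbf K})^\dagger(\nu\mathbf K_s\mathbf y+\frac14\widetilde{\mathbf K}\mathbf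 z)$ is an optimal solution of (1). -/

import Mathlib

open scoped Matrix

namespace DomainAdaptation

/-! ### Moore–Penrose pseudo-inverse of a real matrix -/

/-- The four Penrose equations: `P` is the Moore–Penrose pseudo-inverse of `A`. -/
structure IsMoorePenrose {m n : Type*} [Fintype m] [Fintype n]
    (A : Matrix m n ℝ) (P : Matrix n m ℝ) : Prop where
  mul_mul_self : A * P * A = A
  self_mul_mul : P * A * P = P
  left_symm : (A * P)ᵀ = A * P
  right_symm : (P * A)ᵀ = P * A

theorem exists_isMoorePenrose_of_isHermitian {n : Type*} [Fintype n] [DecidableEq n]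
    {S : Matrix n n ℝ} (hS : S.IsHermitian) :
    ∃ P : Matrix n n ℝ, IsMoorePenrose S P ∧ Pᵀ = P := by
  set U : Matrix n n ℝ := (hS.eigenvectorUnitary : Matrix n n ℝ) with hU
  set d : n → ℝ := hS.eigenvalues with hd
  have hUU : Uᵀ * U = 1 := by
    have h := Unitary.coe_star_mul_self hS.eigenvectorUnitary
    rwa [Matrix.star_eq_conjTranspose, Matrix.conjTranspose_eq_transpose_of_trivial] at h
  have hSU : S = U * Matrix.diagonal d * Uᵀ := by
    have h := hS.spectral_theorem
    rw [Unitary.conjStarAlgAut_apply] at h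
    rw [Matrix.star_eq_conjTranspose, Matrix.conjTranspose_eq_transpose_of_trivial] at h
    exact h
  have key : ∀ e f : n → ℝ, (U * Matrix.diagonal e * Uᵀ) * (U * Matrix.diagonal f * Uᵀ)
      = U * Matrix.diagonal (fun i => e i * f i) * Uᵀ := by
    intro e f
    calc (U * Matrix.diagonal e * Uᵀ) * (U * Matrix.diagonal f * Uᵀ)
        = U * Matrix.diagonal e * (Uᵀ * U) * Matrix.diagonal f * Uᵀ := by
          simp only [Matrix.mul_assoc]
      _ = _ := by
          rw [hUU, Matrix.mul_one, Matrix.mul_assoc U, Matrix.diagonal_mul_diagonal]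
  have symm : ∀ e : n → ℝ, (U * Matrix.diagonal e * Uᵀ)ᵀ = U * Matrix.diagonal e * Uᵀ := by
    intro e
    simp [Matrix.transpose_mul, Matrix.mul_assoc]
  refine ⟨U * Matrix.diagonal (fun i => (d i)⁻¹) * Uᵀ, ⟨?_, ?_, ?_, ?_⟩, symm _⟩
  · rw [hSU, key, key]
    congr 3
    funext i
    exact mul_inv_mul_cancel (d i)
  · rw [hSU, key, key]
    congr 3
    funext i
    simpa using mul_inv_mul_cancel (d i)⁻¹
  · rw [hSU, key, symm]
  · rw [hSU, key, symm]

/-- Every real matrix has a Moore–Penrose pseudo-inverse. -/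
theorem exists_isMoorePenrose {m n : Type*} [Fintype m] [Fintype n]
    (A : Matrix m n ℝ) : ∃ P : Matrix n m ℝ, IsMoorePenrose A P := by
  classical
  have hS : (Aᵀ * A).IsHermitian := by
    have h := Matrix.isHermitian_conjTranspose_mul_self A
    rwa [Matrix.conjTranspose_eq_transpose_of_trivial] at h
  obtain ⟨G, hG, hGs⟩ := exists_isMoorePenrose_of_isHermitian hS
  have h1 := hG.mul_mul_self
  have hz : A * G * (Aᵀ * A) - A = 0 := by
    have hT : (A * G * (Aᵀ * A) - A)ᵀ = Aᵀ * A * G * Aᵀ - Aᵀ := by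
      simp only [Matrix.transpose_sub, Matrix.transpose_mul, Matrix.transpose_transpose, hGs,
        Matrix.mul_assoc]
    have h0 : (A * G * (Aᵀ * A) - A)ᴴ * (A * G * (Aᵀ * A) - A) = 0 := by
      rw [Matrix.conjTranspose_eq_transpose_of_trivial, hT]
      calc (Aᵀ * A * G * Aᵀ - Aᵀ) * (A * G * (Aᵀ * A) - A)
          = (Aᵀ * A * G * (Aᵀ * A)) * G * (Aᵀ * A) - Aᵀ * A * G * (Aᵀ * A)
              - (Aᵀ * A * G * (Aᵀ * A)) + Aᵀ * A := by
            simp only [Matrix.mul_sub, Matrix.sub_mul, Matrix.mul_assoc]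
            abel
        _ = 0 := by rw [h1, h1]; abel
    exact Matrix.conjTranspose_mul_self_eq_zero.mp h0
  refine ⟨G * Aᵀ, ⟨?_, ?_, ?_, ?_⟩⟩
  · have := sub_eq_zero.mp hz
    simpa only [Matrix.mul_assoc] using this
  · have := congrArg (fun M => M * Aᵀ) hG.self_mul_mul
    simpa only [Matrix.mul_assoc] using this
  · simp only [Matrix.transpose_mul, Matrix.transpose_transpose, hGs, Matrix.mul_assoc]
  · have := hG.right_symm
    simpa only [Matrix.mul_assoc] using this

/-- The Moore–Penrose pseudo-inverse `A†` of a real matrix `A`. -/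
noncomputable def pinv {m n : Type*} [Fintype m] [Fintype n]
    (A : Matrix m n ℝ) : Matrix n m ℝ :=
  (exists_isMoorePenrose A).choose

theorem pinv_spec {m n : Type*} [Fintype m] [Fintype n]
    (A : Matrix m n ℝ) : IsMoorePenrose A (pinv A) :=
  (exists_isMoorePenrose A).choose_spec

/-! ### The data of the problem -/

/-- The squared Euclidean norm of a vector. -/
def sqNorm {k : ℕ} (v : Fin k → ℝ) : ℝ := v ⬝ᵥ v

/-- The data from which the optimization problems are formed (raw data only: positive
semidefiniteness of the kernel and the sign conditions are hypotheses where they are needed). -/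
structure Data (X : Type*) (m n : ℕ) where
  /-- the kernel `K : X × X → ℝ` -/
  K : Matrix X X ℝ
  /-- the points of the source sample -/
  x : Fin m → X
  /-- the labels of the source sample -/
  label : Fin m → ℝ
  /-- the points of the (unlabeled) target sample -/
  x' : Fin n → X
  /-- the weights of the source points -/
  q : Fin m → ℝ
  /-- the regularization parameter -/
  lam : ℝ
  /-- the radius of the weighted ball of surrogate labeling functions -/
  r : ℝ

namespace Data

variable {X : Type*} {m n : ℕ} (D : Data X m n)

/-- `K_t`, with entries `n⁻¹ K(x'_i, x'_j)`. -/
noncomputable def Kt : Matrix (Fin n) (Fin n) ℝ :=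
  Matrix.of fun i j => (n : ℝ)⁻¹ * D.K (D.x' i) (D.x' j)

/-- `K_s`, with entries `q_i^{1/2} q_j^{1/2} K(x_i, x_j)`. -/
noncomputable def Ks : Matrix (Fin m) (Fin m) ℝ :=
  Matrix.of fun i j => √(D.q i) * √(D.q j) * D.K (D.x i) (D.x j)

/-- `K_st`, with entries `n^{-1/2} q_j^{1/2} K(x'_i, x_j)`. -/
noncomputable def Kst : Matrix (Fin n) (Fin m) ℝ :=
  Matrix.of fun i j => (√(n : ℝ))⁻¹ * √(D.q j) * D.K (D.x' i) (D.x j)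

/-- The vector `y` of normalized labels `q_i^{1/2} y_i`. -/
noncomputable def y : Fin m → ℝ := fun i => √(D.q i) * D.label i

/-! ### The min–max problem -/

/-- The coefficient set of `H''`: all `a` with `‖K_s a - y‖² ≤ r²`. -/
def ball : Set (Fin m → ℝ) := {a | sqNorm (D.Ks *ᵥ a - D.y) ≤ D.r ^ 2}

/-- `‖K_st a - K_t b‖²`. -/
noncomputable def targetLoss (b : Fin n → ℝ) (a : Fin m → ℝ) : ℝ :=
  sqNorm (D.Kst *ᵥ a - D.Kt *ᵥ b)

/-- The objective of the min–max problem: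
`λ bᵀ K_t b + ½ (max_a ‖K_st a - K_t b‖² + min_a ‖K_st a - K_t b‖²)`, `a` ranging over the ball. -/
noncomputable def objective (b : Fin n → ℝ) : ℝ :=
  D.lam * (b ⬝ᵥ (D.Kt *ᵥ b)) +
    (1 / 2) * (sSup (D.targetLoss b '' D.ball) + sInf (D.targetLoss b '' D.ball))

/-! ### The semidefinite program -/

/-- `λ K_t + K_t²`. -/
noncomputable def M : Matrix (Fin n) (Fin n) ℝ := D.lam • D.Kt + D.Kt * D.Kt

/-- `K̃ = K_stᵀ K_t (λ K_t + K_t²)† K_t K_st`. -/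
noncomputable def Ktilde : Matrix (Fin m) (Fin m) ℝ :=
  D.Kstᵀ * D.Kt * pinv D.M * D.Kt * D.Kst

/-- `ν K_s² + ½ K_stᵀ K_st - ¼ K̃`. -/
noncomputable def B (ν : ℝ) : Matrix (Fin m) (Fin m) ℝ :=
  ν • (D.Ks * D.Ks) + (1 / 2 : ℝ) • (D.Kstᵀ * D.Kst) - (1 / 4 : ℝ) • D.Ktilde

/-- `ν K_s y + ¼ K̃ z`. -/
noncomputable def d (ν : ℝ) (z : Fin m → ℝ) : Fin m → ℝ :=
  ν • (D.Ks *ᵥ D.y) + (1 / 4 : ℝ) • (D.Ktilde *ᵥ z)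

end Data

/-- The bordered matrix with block rows `(A, v)` and `(vᵀ, c)`. -/
def bordered {k : ℕ} (A : Matrix (Fin k) (Fin k) ℝ) (v : Fin k → ℝ) (c : ℝ) :
    Matrix (Fin k ⊕ Unit) (Fin k ⊕ Unit) ℝ :=
  Matrix.fromBlocks A (Matrix.of fun i _ => v i) (Matrix.of fun _ j => v j)
    (Matrix.of fun _ _ => c)

/-- The variables `(α, β, ν, Z, z)` of the semidefinite program. -/
structure SDPVar (m : ℕ) where
  α : ℝ
  β : ℝ
  ν : ℝ
  Z : Matrix (Fin m) (Fin m) ℝ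
  z : Fin m → ℝ

namespace Data

variable {X : Type*} {m n : ℕ} (D : Data X m n)

/-- The constraints of the semidefinite program. -/
structure SDPFeasible (p : SDPVar m) : Prop where
  psd_dual : (bordered (D.B p.ν) (D.d p.ν p.z) (p.α + p.ν * (sqNorm D.y - D.r ^ 2))).PosSemidef
  psd_moment : (bordered p.Z p.z 1).PosSemidef
  psd_beta :
    (bordered D.M ((1 / 2 : ℝ) • (D.Kt *ᵥ (D.Kst *ᵥ p.z))) p.β).PosSemidef
  trace_le : (D.Ks * D.Ks * p.Z).trace - 2 * (D.y ⬝ᵥ (D.Ks *ᵥ p.z)) + sqNorm D.y ≤ D.r ^ 2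
  nu_nonneg : 0 ≤ p.ν

/-- The objective of the semidefinite program: `½ Tr(K_stᵀ K_st Z) - β - α`. -/
noncomputable def sdpObjective (p : SDPVar m) : ℝ :=
  (1 / 2) * (D.Kstᵀ * D.Kst * p.Z).trace - p.β - p.α

/-- The coefficient vector of the candidate hypothesis read off from a point of the semidefinite
program: `b = ½ (λ K_t + K_t²)† K_t K_st (a + z)` with
`a = (ν K_s² + ½ K_stᵀ K_st - ¼ K̃)† (ν K_s y + ¼ K̃ z)`. -/
noncomputable def recover (p : SDPVar m) : Fin n → ℝ :=
  (1 / 2 : ℝ) •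
    (pinv D.M *ᵥ (D.Kt *ᵥ (D.Kst *ᵥ (pinv (D.B p.ν) *ᵥ D.d p.ν p.z + p.z))))

end Data

end DomainAdaptation

/-! Write `M = λ K_t + K_t²` and `N = K_t M† K_t`. If the minimizing and maximizing choices of `a`
have images `s` and `u` under `K_st`, the part of (1) depending on `b` is `bᵀ M b - (s + u)ᵀ K_t b`.
Completing the square gives the minimum `-¼ (s + u)ᵀ N (s + u)`, at `b = ½ M† K_t (s + u)`. This
turns (1) into a game with the value function `payoff`: one player picks `s` in the image of the
ball, the other picks moments `(τ, u)` in the convex hull of the points `(½ |s|², s)`. Since `0 ≤ N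
≤ 1`, the payoff is convex in `s` and concave in `(τ, u)`, so Sion's theorem gives a saddle point
(`exists_saddle`). The first-order condition of the maximizer shows that the corresponding `b` has
objective at most the saddle value (`objective_le_payoff`).

In (2), `(Z, z)` encodes the moments, `β` bounds `¼ uᵀ N u`, and the block with `α` and `ν` is the
Lagrangian dual of the minimization over the ball. An exact multiplier exists under strict
feasibility; otherwise a large one loses arbitrarily little.

Weak duality holds because the moment relaxation is tight (`exists_mem_ball_of_moments`): a
covariance is absorbed into the mean one rank-one term at a time. The gap then dominates a sum of
two nonnegative quadratics (`squares_le_gap`). At zero gap both vanish, which determines `K_t b` and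
yields the recovery formula. -/

namespace DomainAdaptation

open Matrix

/-! ### Quadratic forms, bordered matrices and moment matrices -/

section LinearAlgebra

variable {k l : ℕ}

theorem sqNorm_nonneg (v : Fin k → ℝ) : 0 ≤ sqNorm v := by
  simpa [sqNorm] using dotProduct_star_self_nonneg v

theorem sqNorm_eq_zero {v : Fin k → ℝ} : sqNorm v = 0 ↔ v = 0 := dotProduct_self_eq_zero

@[simp] theorem sqNorm_zero : sqNorm (0 : Fin k → ℝ) = 0 := by simp [sqNorm]

theorem sqNorm_add (v w : Fin k → ℝ) : sqNorm (v + w) = sqNorm v + 2 * (v ⬝ᵥ w) + sqNorm w := by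
  simp only [sqNorm, add_dotProduct, dotProduct_add, dotProduct_comm w v]
  ring

theorem sqNorm_sub (v w : Fin k → ℝ) : sqNorm (v - w) = sqNorm v - 2 * (v ⬝ᵥ w) + sqNorm w := by
  simp only [sqNorm, sub_dotProduct, dotProduct_sub, dotProduct_comm w v]
  ring

theorem sqNorm_smul (c : ℝ) (v : Fin k → ℝ) : sqNorm (c • v) = c ^ 2 * sqNorm v := by
  simp only [sqNorm, smul_dotProduct, dotProduct_smul, smul_eq_mul]
  ring

theorem continuous_sqNorm : Continuous (sqNorm : (Fin k → ℝ) → ℝ) := by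
  unfold sqNorm; fun_prop

theorem sq_le_sqNorm (v : Fin k → ℝ) (i : Fin k) : v i ^ 2 ≤ sqNorm v := by
  have := Finset.single_le_sum (f := fun j => v j * v j)
    (fun j _ => mul_self_nonneg (v j)) (Finset.mem_univ i)
  simpa [sqNorm, dotProduct, sq] using this

theorem dotProduct_transpose_mul_mulVec (A : Matrix (Fin k) (Fin l) ℝ) (v w : Fin l → ℝ) :
    v ⬝ᵥ ((Aᵀ * A) *ᵥ w) = (A *ᵥ v) ⬝ᵥ (A *ᵥ w) := by
  rw [← mulVec_mulVec, dotProduct_mulVec, vecMul_transpose]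

theorem dotProduct_mulVec_comm {A : Matrix (Fin k) (Fin k) ℝ} (hA : Aᵀ = A) (v w : Fin k → ℝ) :
    v ⬝ᵥ (A *ᵥ w) = w ⬝ᵥ (A *ᵥ v) := by
  rw [dotProduct_mulVec, ← mulVec_transpose, hA, dotProduct_comm]

theorem quadForm_nonneg {A : Matrix (Fin k) (Fin k) ℝ} (hA : A.PosSemidef) (v : Fin k → ℝ) :
    0 ≤ v ⬝ᵥ (A *ᵥ v) := by
  simpa using hA.dotProduct_mulVec_nonneg v

theorem transpose_eq_of_posSemidef {ι : Type*} {A : Matrix ι ι ℝ} (hA : A.PosSemidef) : Aᵀ = A := by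
  rw [← conjTranspose_eq_transpose_of_trivial]; exact hA.isHermitian

theorem posSemidef_of_nonneg {ι : Type*} [Fintype ι] {A : Matrix ι ι ℝ} (hA : Aᵀ = A)
    (h : ∀ v, 0 ≤ v ⬝ᵥ (A *ᵥ v)) : A.PosSemidef := by
  refine .of_dotProduct_mulVec_nonneg ?_ fun v => ?_
  · rwa [IsHermitian, conjTranspose_eq_transpose_of_trivial]
  · simpa using h v

/-- If `A` vanishes on the kernel of `B`, then it factors through `B`. -/
theorem mul_pinv_mul_of_ker_le {p : ℕ} {A : Matrix (Fin p) (Fin k) ℝ} {B : Matrix (Fin l) (Fin k) ℝ}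
    (h : ∀ v, B *ᵥ v = 0 → A *ᵥ v = 0) : A * pinv B * B = A := by
  refine ext_of_mulVec_single fun i => ?_
  have h1 : B *ᵥ ((pinv B * B) *ᵥ Pi.single i 1 - Pi.single i 1) = 0 := by
    rw [mulVec_sub, mulVec_mulVec, ← Matrix.mul_assoc, (pinv_spec B).mul_mul_self, sub_self]
  have h2 := h _ h1
  rw [mulVec_sub, sub_eq_zero, mulVec_mulVec, ← Matrix.mul_assoc] at h2
  exact h2

theorem bordered_form (A : Matrix (Fin k) (Fin k) ℝ) (v : Fin k → ℝ) (c t : ℝ) (a : Fin k → ℝ) :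
    Sum.elim a (fun _ : Unit => t) ⬝ᵥ (bordered A v c *ᵥ Sum.elim a (fun _ => t)) =
      a ⬝ᵥ (A *ᵥ a) + 2 * t * (a ⬝ᵥ v) + t ^ 2 * c := by
  have h1 : (Matrix.of fun (i : Fin k) (_ : Unit) => v i) *ᵥ (fun _ => t) = t • v := by
    ext i; simp [mulVec, dotProduct, mul_comm]
  have h2 : (Matrix.of fun (_ : Unit) (j : Fin k) => v j) *ᵥ a = fun _ => a ⬝ᵥ v := by
    ext i; simp [mulVec, dotProduct, mul_comm]
  have h3 : (Matrix.of fun (_ : Unit) (_ : Unit) => c) *ᵥ (fun _ => t) = fun _ => t * c := by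
    ext i; simp [mulVec, dotProduct, mul_comm]
  rw [bordered, fromBlocks_mulVec]
  simp only [Sum.elim_comp_inl, Sum.elim_comp_inr, h1, h2, h3, sumElim_dotProduct_sumElim,
    dotProduct_add, dotProduct_smul, smul_eq_mul]
  simp [dotProduct]
  ring

theorem nonneg_of_bordered {A : Matrix (Fin k) (Fin k) ℝ} {v : Fin k → ℝ} {c : ℝ}
    (h : (bordered A v c).PosSemidef) (t : ℝ) (a : Fin k → ℝ) :
    0 ≤ a ⬝ᵥ (A *ᵥ a) + 2 * t * (a ⬝ᵥ v) + t ^ 2 * c := by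
  rw [← bordered_form]
  simpa using h.dotProduct_mulVec_nonneg (Sum.elim a (fun _ : Unit => t))

theorem bordered_transpose {A : Matrix (Fin k) (Fin k) ℝ} (hA : Aᵀ = A) (v : Fin k → ℝ) (c : ℝ) :
    (bordered A v c)ᵀ = bordered A v c := by
  rw [bordered, fromBlocks_transpose, hA]
  rfl

theorem bordered_posSemidef {A : Matrix (Fin k) (Fin k) ℝ} {v : Fin k → ℝ} {c : ℝ}
    (hA : A.PosSemidef) (h : ∀ a, 0 ≤ a ⬝ᵥ (A *ᵥ a) + 2 * (a ⬝ᵥ v) + c) :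
    (bordered A v c).PosSemidef := by
  refine posSemidef_of_nonneg (bordered_transpose (transpose_eq_of_posSemidef hA) v c) fun x => ?_
  obtain ⟨a, t, rfl⟩ : ∃ (a : Fin k → ℝ) (t : ℝ), x = Sum.elim a (fun _ => t) :=
    ⟨x ∘ Sum.inl, x (Sum.inr ()), by ext (i | i) <;> simp⟩
  rw [bordered_form]
  rcases eq_or_ne t 0 with rfl | ht
  · simpa using quadForm_nonneg hA a
  -- By homogeneity the form at `(a, t)` is `t²` times the form at `(t⁻¹ a, 1)`.
  · have h1 := mul_nonneg (sq_nonneg t) (h (t⁻¹ • a))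
    simp only [mulVec_smul, dotProduct_smul, smul_dotProduct, smul_eq_mul] at h1
    have h2 : t * t⁻¹ = 1 := mul_inv_cancel₀ ht
    refine h1.trans_eq ?_
    linear_combination (((a ⬝ᵥ (A *ᵥ a)) * (t * t⁻¹ + 1) + 2 * t * (a ⬝ᵥ v))) * h2

/-- A moment matrix splits into the mean and a finite family of deviations. -/
theorem exists_deviations {Z : Matrix (Fin k) (Fin k) ℝ} {z : Fin k → ℝ}
    (h : (bordered Z z 1).PosSemidef) :
    ∃ V : Fin k → Fin k → ℝ, Z = vecMulVec z z + ∑ i, vecMulVec (V i) (V i) := by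
  have hZ : Zᵀ = Z := by
    have := transpose_eq_of_posSemidef h
    rw [bordered, fromBlocks_transpose, fromBlocks_inj] at this
    exact this.1
  have hP : (Z - vecMulVec z z).PosSemidef := by
    refine posSemidef_of_nonneg ?_ fun a => ?_
    · rw [transpose_sub, hZ, transpose_vecMulVec]
    -- Schur complement: `t = -aᵀ z` minimizes the bordered form over `t`.
    · have := nonneg_of_bordered h (-(a ⬝ᵥ z)) a
      simp only [sub_mulVec, vecMulVec_mulVec, dotProduct_sub, dotProduct_comm z a]
      simp only [op_smul_eq_smul, dotProduct_smul, smul_eq_mul]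
      linarith
  open scoped MatrixOrder in
  obtain ⟨B, hB⟩ := CStarAlgebra.nonneg_iff_eq_star_mul_self.mp (nonneg_iff_posSemidef.mpr hP)
  -- The deviations are the rows of `B`, where `Z - z zᵀ = Bᵀ B`.
  refine ⟨B, ?_⟩
  rw [← sub_eq_iff_eq_add', hB]
  ext i j
  simp [Matrix.sum_apply, star_eq_conjTranspose, Matrix.mul_apply, vecMulVec_apply]

theorem trace_transpose_mul_vecMulVec (A : Matrix (Fin l) (Fin k) ℝ) (v : Fin k → ℝ) :
    (Aᵀ * A * vecMulVec v v).trace = sqNorm (A *ᵥ v) := by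
  rw [mul_vecMulVec, trace_vecMulVec, dotProduct_comm, dotProduct_transpose_mul_mulVec, sqNorm]

end LinearAlgebra

/-! ### Compact convex hulls and the saddle point -/

section Minimax

/-- In a finite-dimensional space the convex hull of a compact set is compact. -/
theorem isCompact_convexHull_of_finiteDimensional {E : Type*} [NormedAddCommGroup E]
    [NormedSpace ℝ E] [FiniteDimensional ℝ E] {s : Set E} (hs : IsCompact s) :
    IsCompact (convexHull ℝ s) := by
  classical
  set d := Module.finrank ℝ E + 1
  have hK : IsCompact ((fun p : (Fin d → ℝ) × (Fin d → E) => ∑ i, p.1 i • p.2 i) ''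
      (stdSimplex ℝ (Fin d) ×ˢ Set.univ.pi fun _ => s)) :=
    ((isCompact_stdSimplex ℝ (Fin d)).prod (isCompact_univ_pi fun _ => hs)).image (by fun_prop)
  convert hK using 1
  ext x
  constructor
  · intro hx
    -- Carathéodory: affine independence bounds the number of points by `d`; unused slots get weight
    -- zero and a dummy point of `s`.
    obtain ⟨ι, _, z, w, hz, haff, hw, hw1, rfl⟩ := eq_pos_convex_span_of_mem_convexHull hx
    have hcard : Fintype.card ι ≤ Fintype.card (Fin d) := by
      rw [Fintype.card_fin]
      exact haff.card_le_finrank_succ.trans (Nat.succ_le_succ (Submodule.finrank_le _))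
    obtain ⟨e⟩ := Function.Embedding.nonempty_of_card_le hcard
    have hne : Nonempty ι := by
      by_contra h
      rw [not_nonempty_iff] at h
      simp at hw1
    obtain ⟨i₀⟩ := hne
    have hw0 : ∀ j ∉ Set.range e, Function.extend e w (fun _ => (0 : ℝ)) j = 0 := fun j hj =>
      Function.extend_apply' w _ j hj
    refine ⟨(Function.extend e w fun _ => 0, Function.extend e z fun _ => z i₀),
      ⟨⟨fun j => ?_, ?_⟩, ?_⟩, ?_⟩
    · by_cases hj : j ∈ Set.range e
      · obtain ⟨i, rfl⟩ := hj
        simpa [e.injective.extend_apply] using (hw i).le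
      · exact (hw0 j hj).ge
    · rw [← hw1]
      exact (Fintype.sum_of_injective e e.injective _ _ hw0 fun i =>
        (e.injective.extend_apply ..).symm).symm
    · intro j _
      by_cases hj : j ∈ Set.range e
      · obtain ⟨i, rfl⟩ := hj
        simpa [e.injective.extend_apply] using hz (Set.mem_range_self i)
      · simpa [Function.extend_apply' z (fun _ => z i₀) j hj] using hz (Set.mem_range_self i₀)
    · refine (Fintype.sum_of_injective e e.injective _ _ (fun j hj => ?_) fun i => ?_).symm
      · simp only [hw0 j hj, zero_smul]
      · simp only [e.injective.extend_apply]
  · rintro ⟨⟨w, z⟩, ⟨⟨hw, hw1⟩, hz⟩, rfl⟩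
    exact mem_convexHull_of_exists_fintype w z hw hw1 (fun i => hz i trivial) rfl

variable {k : ℕ}

theorem quadForm_add {N : Matrix (Fin k) (Fin k) ℝ} (hN : Nᵀ = N) (v w : Fin k → ℝ) :
    (v + w) ⬝ᵥ (N *ᵥ (v + w)) = v ⬝ᵥ (N *ᵥ v) + 2 * (v ⬝ᵥ (N *ᵥ w)) + w ⬝ᵥ (N *ᵥ w) := by
  simp only [add_dotProduct, mulVec_add, dotProduct_add, dotProduct_mulVec_comm hN w v]
  ring

theorem quadForm_smul (N : Matrix (Fin k) (Fin k) ℝ) (c : ℝ) (v : Fin k → ℝ) :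
    (c • v) ⬝ᵥ (N *ᵥ (c • v)) = c ^ 2 * (v ⬝ᵥ (N *ᵥ v)) := by
  simp only [mulVec_smul, dotProduct_smul, smul_dotProduct, smul_eq_mul]
  ring

theorem quadForm_convexComb {N : Matrix (Fin k) (Fin k) ℝ} (hN : Nᵀ = N) {a b : ℝ} (hab : a + b = 1)
    (v w : Fin k → ℝ) :
    (a • v + b • w) ⬝ᵥ (N *ᵥ (a • v + b • w)) =
      a * (v ⬝ᵥ (N *ᵥ v)) + b * (w ⬝ᵥ (N *ᵥ w)) - a * b * ((v - w) ⬝ᵥ (N *ᵥ (v - w))) := by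
  obtain rfl : b = 1 - a := by linarith
  simp only [add_dotProduct, mulVec_add, dotProduct_add, sub_dotProduct, mulVec_sub, dotProduct_sub,
    mulVec_smul, dotProduct_smul, smul_dotProduct, smul_eq_mul, dotProduct_mulVec_comm hN w v]
  ring

/-- Letting `ε → 0` after division by `ε` is how first-order conditions are extracted below. -/
theorem nonpos_of_forall_le_mul {x c : ℝ} (h : ∀ ε : ℝ, 0 < ε → ε ≤ 1 → x ≤ ε * c) : x ≤ 0 := by
  by_contra! hx
  have h1 := h 1 one_pos le_rfl
  have hc : 0 < c := by linarith
  have h2 := h (min 1 (x / (2 * c))) (by positivity) (min_le_left _ _)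
  have h3 : min 1 (x / (2 * c)) * c ≤ x / (2 * c) * c := by gcongr; exact min_le_right _ _
  have h4 : x / (2 * c) * c = x / 2 := by field_simp
  linarith

/-- The payoff `τ + ½ |s|² - ¼ (s + u)ᵀ N (s + u)`. -/
noncomputable def payoff (N : Matrix (Fin k) (Fin k) ℝ) (s : Fin k → ℝ) (p : ℝ × (Fin k → ℝ)) : ℝ :=
  p.1 + 1 / 2 * sqNorm s - 1 / 4 * ((s + p.2) ⬝ᵥ (N *ᵥ (s + p.2)))

/-- The Hessian in `s` is `1 - ½ N`, which `N ≤ 1` makes positive semidefinite. -/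
theorem convexOn_payoff {N : Matrix (Fin k) (Fin k) ℝ} (hN : Nᵀ = N)
    (hN1 : ∀ v, v ⬝ᵥ (N *ᵥ v) ≤ sqNorm v) {U : Set (Fin k → ℝ)} (hU : Convex ℝ U)
    (p : ℝ × (Fin k → ℝ)) : ConvexOn ℝ U fun s => payoff N s p := by
  refine ⟨hU, fun v _ w _ a b ha hb hab => ?_⟩
  have h1 : a • v + b • w + p.2 = a • (v + p.2) + b • (w + p.2) := by
    conv_lhs => rw [← one_smul ℝ p.2, ← hab]
    module
  have h2 := quadForm_convexComb (N := 1) transpose_one hab v w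
  have h3 := hN1 (v - w)
  simp only [payoff, h1, quadForm_convexComb hN hab, add_sub_add_right_eq_sub, smul_eq_mul]
  simp only [one_mulVec] at h2
  simp only [sqNorm] at h3 ⊢
  rw [h2]
  have h4 := dotProduct_star_self_nonneg (v - w)
  simp only [star_trivial] at h4
  have h5 := mul_nonneg (mul_nonneg ha hb) (by linarith :
    0 ≤ 1 / 2 * ((v - w) ⬝ᵥ (v - w)) - 1 / 4 * ((v - w) ⬝ᵥ (N *ᵥ (v - w))))
  obtain rfl : b = 1 - a := by linarith
  linarith

theorem concaveOn_payoff {N : Matrix (Fin k) (Fin k) ℝ} (hN : N.PosSemidef)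
    {P : Set (ℝ × (Fin k → ℝ))} (hP : Convex ℝ P) (s : Fin k → ℝ) :
    ConcaveOn ℝ P (payoff N s) := by
  refine ⟨hP, fun p _ q _ a b ha hb hab => ?_⟩
  have h1 : s + (a • p + b • q).2 = a • (s + p.2) + b • (s + q.2) := by
    conv_lhs => rw [← one_smul ℝ s, ← hab]
    simp only [Prod.snd_add, Prod.smul_snd]
    module
  have h2 : (s + p.2) - (s + q.2) = p.2 - q.2 := by abel
  simp only [payoff, h1, quadForm_convexComb (transpose_eq_of_posSemidef hN) hab, h2, smul_eq_mul,
    Prod.fst_add, Prod.smul_fst]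
  have h5 := mul_nonneg (mul_nonneg ha hb) (quadForm_nonneg hN (p.2 - q.2))
  obtain rfl : b = 1 - a := by linarith
  linarith

theorem continuous_payoff_left (N : Matrix (Fin k) (Fin k) ℝ) (p : ℝ × (Fin k → ℝ)) :
    Continuous fun s => payoff N s p := by
  unfold payoff sqNorm; fun_prop

theorem continuous_payoff_right (N : Matrix (Fin k) (Fin k) ℝ) (s : Fin k → ℝ) :
    Continuous (payoff N s) := by
  unfold payoff sqNorm; fun_prop

/-- A saddle point of the payoff between a compact convex set and the moments of its points,
together with the first-order condition of the maximizing player. -/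
theorem exists_saddle {N : Matrix (Fin k) (Fin k) ℝ} (hN : N.PosSemidef)
    (hN1 : ∀ v, v ⬝ᵥ (N *ᵥ v) ≤ sqNorm v) {U : Set (Fin k → ℝ)} (hU : Convex ℝ U)
    (hUc : IsCompact U) (hne : U.Nonempty) :
    ∃ s ∈ U, ∃ p ∈ convexHull ℝ ((fun s => (1 / 2 * sqNorm s, s)) '' U),
      (∀ t ∈ U, payoff N s p ≤ payoff N t p) ∧
      ∀ t ∈ U, 1 / 2 * sqNorm t - 1 / 2 * ((s + p.2) ⬝ᵥ (N *ᵥ t)) ≤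
        p.1 - 1 / 2 * ((s + p.2) ⬝ᵥ (N *ᵥ p.2)) := by
  have hNs := transpose_eq_of_posSemidef hN
  set P := convexHull ℝ ((fun s : Fin k → ℝ => (1 / 2 * sqNorm s, s)) '' U) with hP
  have hPc : IsCompact P := isCompact_convexHull_of_finiteDimensional
    (hUc.image ((continuous_const.mul continuous_sqNorm).prodMk continuous_id))
  obtain ⟨s, hs, p, hp, h⟩ := Sion.exists_isSaddlePointOn (f := payoff N) hne hU hUc
    (fun p _ => (continuous_payoff_left N p).lowerSemicontinuous.lowerSemicontinuousOn _)
    (fun p _ => (convexOn_payoff hNs hN1 hU p).quasiconvexOn)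
    (convex_convexHull ℝ _) (hne.image _).convexHull hPc
    (fun s _ => (continuous_payoff_right N s).upperSemicontinuous.upperSemicontinuousOn _)
    (fun s _ => (concaveOn_payoff hN (convex_convexHull ℝ _) s).quasiconcaveOn)
  refine ⟨s, hs, p, hp, fun t ht => h t ht p hp, fun t ht => ?_⟩
  have hq : (1 / 2 * sqNorm t, t) ∈ P := subset_convexHull ℝ _ ⟨t, ht, rfl⟩
  -- Directional derivative at `p` towards the vertex of the hull given by `t`; maximality of `p`
  -- makes it nonpositive.
  have key : 1 / 2 * sqNorm t - p.1 - 1 / 2 * ((s + p.2) ⬝ᵥ (N *ᵥ (t - p.2))) ≤ 0 := by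
    refine nonpos_of_forall_le_mul (c := 1 / 4 * ((t - p.2) ⬝ᵥ (N *ᵥ (t - p.2)))) fun ε h0 h1 => ?_
    have hmem := (convex_convexHull ℝ _).add_smul_sub_mem hp hq ⟨h0.le, h1⟩
    have h2 := h s hs _ hmem
    have h3 : s + (p + ε • ((1 / 2 * sqNorm t, t) - p)).2 = (s + p.2) + ε • (t - p.2) := by
      simp [add_assoc]
    rw [payoff, payoff, h3, quadForm_add hNs, quadForm_smul] at h2
    simp only [mulVec_smul, dotProduct_smul, Prod.fst_add, Prod.smul_fst, Prod.fst_sub,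
      smul_eq_mul] at h2
    refine le_of_mul_le_mul_left ?_ h0
    linarith
  rw [mulVec_sub, dotProduct_sub] at key
  linarith

end Minimax

/-! ### Kernel matrices and the regularized normal equation -/

namespace Data

variable {X : Type*} {m n : ℕ} {D : Data X m n}

theorem Kt_posSemidef (hK : D.K.PosSemidef) : D.Kt.PosSemidef := by
  have h : D.Kt = (n : ℝ)⁻¹ • D.K.submatrix D.x' D.x' := by ext i j; simp [Kt]
  rw [h]
  exact (hK.submatrix D.x').smul (by positivity)

theorem Ks_transpose (hK : D.K.PosSemidef) : D.Ksᵀ = D.Ks := by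
  ext i j
  have h := congrFun (congrFun (transpose_eq_of_posSemidef hK) (D.x i)) (D.x j)
  rw [transpose_apply] at h
  simp [Ks, h, mul_comm]

/-- Cauchy–Schwarz for the kernel: `K_st` vanishes on the kernel of `K_s`. -/
theorem Kst_mulVec_eq_zero (hK : D.K.PosSemidef) {v : Fin m → ℝ} (hv : D.Ks *ᵥ v = 0) :
    D.Kst *ᵥ v = 0 := by
  set G := D.K.submatrix (Sum.elim D.x' D.x) (Sum.elim D.x' D.x) with hG
  have hGp : G.PosSemidef := hK.submatrix _
  set f : Fin n ⊕ Fin m → ℝ := Sum.elim 0 fun j => √(D.q j) * v j with hf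
  have h1 : star f ⬝ᵥ (G *ᵥ f) = v ⬝ᵥ (D.Ks *ᵥ v) := by
    simp only [hG, hf, star_trivial, mulVec, dotProduct, Fintype.sum_sum_type, Sum.elim_inl,
      Sum.elim_inr, submatrix_apply, Ks, of_apply, Pi.zero_apply, zero_mul, mul_zero,
      Finset.sum_const_zero, zero_add, Finset.mul_sum]
    refine Finset.sum_congr rfl fun i _ => Finset.sum_congr rfl fun j _ => ?_
    ring
  -- A zero of a positive semidefinite form lies in the kernel of the joint Gram matrix, whose
  -- target rows give `K_st v` up to scaling.
  rw [hv, dotProduct_zero, hGp.dotProduct_mulVec_zero_iff] at h1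
  ext i
  have h2 := congrFun h1 (Sum.inl i)
  simp only [hG, hf, mulVec, dotProduct, Fintype.sum_sum_type, Sum.elim_inl, Sum.elim_inr,
    submatrix_apply, Pi.zero_apply, mul_zero, Finset.sum_const_zero, zero_add] at h2
  simp only [mulVec, dotProduct, Kst, of_apply, Pi.zero_apply]
  rw [← mul_zero (√(n : ℝ))⁻¹, ← h2, Finset.mul_sum]
  refine Finset.sum_congr rfl fun j _ => ?_
  ring

theorem Kst_factor (hK : D.K.PosSemidef) : D.Kst * pinv D.Ks * D.Ks = D.Kst :=
  mul_pinv_mul_of_ker_le fun _ => Kst_mulVec_eq_zero hK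

theorem M_form (hK : D.K.PosSemidef) (v : Fin n → ℝ) :
    v ⬝ᵥ (D.M *ᵥ v) = D.lam * (v ⬝ᵥ (D.Kt *ᵥ v)) + sqNorm (D.Kt *ᵥ v) := by
  have h := dotProduct_transpose_mul_mulVec D.Kt v v
  rw [transpose_eq_of_posSemidef (Kt_posSemidef hK)] at h
  rw [M, add_mulVec, dotProduct_add, h, smul_mulVec, dotProduct_smul, smul_eq_mul, sqNorm]

theorem M_posSemidef (hK : D.K.PosSemidef) (hlam : 0 ≤ D.lam) : D.M.PosSemidef := by
  refine posSemidef_of_nonneg ?_ fun v => ?_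
  · simp [M, transpose_eq_of_posSemidef (Kt_posSemidef hK)]
  · rw [M_form hK]
    exact add_nonneg (mul_nonneg hlam (quadForm_nonneg (Kt_posSemidef hK) v)) (sqNorm_nonneg _)

theorem Kt_mulVec_eq_zero (hK : D.K.PosSemidef) (hlam : 0 ≤ D.lam) {v : Fin n → ℝ}
    (hv : v ⬝ᵥ (D.M *ᵥ v) = 0) : D.Kt *ᵥ v = 0 := by
  rw [M_form hK] at hv
  have h1 := mul_nonneg hlam (quadForm_nonneg (Kt_posSemidef hK) v)
  have h2 := sqNorm_nonneg (D.Kt *ᵥ v)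
  exact sqNorm_eq_zero.mp (by linarith)

theorem Kt_pinv_M (hK : D.K.PosSemidef) (hlam : 0 ≤ D.lam) : D.Kt * pinv D.M * D.M = D.Kt :=
  mul_pinv_mul_of_ker_le fun v hv => Kt_mulVec_eq_zero hK hlam (by rw [hv, dotProduct_zero])

/-- The normal equation is solvable even for singular `M`, because the range of `K_t` lies in that
of `M`. -/
theorem M_pinv_Kt (hK : D.K.PosSemidef) (hlam : 0 ≤ D.lam) : D.M * pinv D.M * D.Kt = D.Kt := by
  have h1 := congrArg transpose (Kt_pinv_M hK hlam)
  simp only [transpose_mul, transpose_eq_of_posSemidef (Kt_posSemidef hK),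
    transpose_eq_of_posSemidef (M_posSemidef hK hlam)] at h1
  rw [← h1, ← Matrix.mul_assoc, (pinv_spec D.M).mul_mul_self]

/-- The matrix `K_t (λ K_t + K_t²)† K_t`. -/
noncomputable def N (D : Data X m n) : Matrix (Fin n) (Fin n) ℝ := D.Kt * pinv D.M * D.Kt

/-- The solution `(λ K_t + K_t²)† K_t u` of the normal equation. -/
noncomputable def ridge (D : Data X m n) (u : Fin n → ℝ) : Fin n → ℝ := pinv D.M *ᵥ (D.Kt *ᵥ u)

theorem Kt_ridge (u : Fin n → ℝ) : D.Kt *ᵥ D.ridge u = D.N *ᵥ u := by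
  simp [ridge, N, mulVec_mulVec, Matrix.mul_assoc]

theorem M_ridge (hK : D.K.PosSemidef) (hlam : 0 ≤ D.lam) (u : Fin n → ℝ) :
    D.M *ᵥ D.ridge u = D.Kt *ᵥ u := by
  rw [ridge, mulVec_mulVec, mulVec_mulVec, M_pinv_Kt hK hlam]

theorem dotProduct_M_ridge (hK : D.K.PosSemidef) (hlam : 0 ≤ D.lam) (b u : Fin n → ℝ) :
    b ⬝ᵥ (D.M *ᵥ D.ridge u) = u ⬝ᵥ (D.Kt *ᵥ b) := by
  rw [M_ridge hK hlam, dotProduct_mulVec_comm (transpose_eq_of_posSemidef (Kt_posSemidef hK))]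

theorem ridge_form (hK : D.K.PosSemidef) (hlam : 0 ≤ D.lam) (u v : Fin n → ℝ) :
    D.ridge u ⬝ᵥ (D.M *ᵥ D.ridge v) = v ⬝ᵥ (D.N *ᵥ u) := by
  rw [dotProduct_M_ridge hK hlam, Kt_ridge]

theorem N_transpose (hK : D.K.PosSemidef) (hlam : 0 ≤ D.lam) : D.Nᵀ = D.N := by
  have hKt := transpose_eq_of_posSemidef (Kt_posSemidef hK)
  have hM := transpose_eq_of_posSemidef (M_posSemidef hK hlam)
  have h1 := congrArg transpose (Kt_pinv_M hK hlam)
  simp only [transpose_mul, hKt, hM] at h1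
  calc D.Nᵀ = D.Kt * (pinv D.M)ᵀ * D.Kt := by simp only [N, transpose_mul, hKt, Matrix.mul_assoc]
    _ = D.Kt * pinv D.M * D.M * ((pinv D.M)ᵀ * D.Kt) := by
      rw [Kt_pinv_M hK hlam, Matrix.mul_assoc]
    _ = D.N := by rw [Matrix.mul_assoc, h1, N]

theorem N_posSemidef (hK : D.K.PosSemidef) (hlam : 0 ≤ D.lam) : D.N.PosSemidef :=
  posSemidef_of_nonneg (N_transpose hK hlam) fun v => by
    rw [← ridge_form hK hlam]
    exact quadForm_nonneg (M_posSemidef hK hlam) _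

/-- The ridge identity gives `|N u|² ≤ uᵀ N u`; expanding `|u - N u|² ≥ 0` finishes. -/
theorem N_le (hK : D.K.PosSemidef) (hlam : 0 ≤ D.lam) (u : Fin n → ℝ) :
    u ⬝ᵥ (D.N *ᵥ u) ≤ sqNorm u := by
  have h1 := ridge_form hK hlam u u
  rw [M_form hK, Kt_ridge] at h1
  have h2 := mul_nonneg hlam (quadForm_nonneg (Kt_posSemidef hK) (D.ridge u))
  have h3 := sqNorm_nonneg (u - D.N *ᵥ u)
  rw [sqNorm_sub] at h3
  rw [Kt_ridge] at h2
  linarith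

theorem M_square (hK : D.K.PosSemidef) (hlam : 0 ≤ D.lam) (b u : Fin n → ℝ) :
    (b - (1 / 2 : ℝ) • D.ridge u) ⬝ᵥ (D.M *ᵥ (b - (1 / 2 : ℝ) • D.ridge u)) =
      b ⬝ᵥ (D.M *ᵥ b) - u ⬝ᵥ (D.Kt *ᵥ b) + 1 / 4 * (u ⬝ᵥ (D.N *ᵥ u)) := by
  rw [sub_eq_add_neg, ← neg_smul,
    quadForm_add (transpose_eq_of_posSemidef (M_posSemidef hK hlam)), quadForm_smul,
    ridge_form hK hlam, mulVec_smul, dotProduct_smul, dotProduct_M_ridge hK hlam, smul_eq_mul]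
  ring

theorem Ktilde_form (a z : Fin m → ℝ) :
    a ⬝ᵥ (D.Ktilde *ᵥ z) = (D.Kst *ᵥ a) ⬝ᵥ (D.N *ᵥ (D.Kst *ᵥ z)) := by
  have h : D.Ktilde *ᵥ z = D.Kstᵀ *ᵥ (D.N *ᵥ (D.Kst *ᵥ z)) := by
    simp only [Ktilde, N, mulVec_mulVec, Matrix.mul_assoc]
  rw [h, dotProduct_mulVec, vecMul_transpose]

theorem Ks_mul_Ks (hK : D.K.PosSemidef) : D.Ks * D.Ks = D.Ksᵀ * D.Ks := by rw [Ks_transpose hK]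

theorem B_form (hK : D.K.PosSemidef) (ν : ℝ) (a : Fin m → ℝ) :
    a ⬝ᵥ (D.B ν *ᵥ a) = ν * sqNorm (D.Ks *ᵥ a) + 1 / 2 * sqNorm (D.Kst *ᵥ a) -
      1 / 4 * ((D.Kst *ᵥ a) ⬝ᵥ (D.N *ᵥ (D.Kst *ᵥ a))) := by
  simp only [B, sub_mulVec, add_mulVec, smul_mulVec, dotProduct_sub, dotProduct_add,
    dotProduct_smul, smul_eq_mul, Ktilde_form, Ks_mul_Ks hK, dotProduct_transpose_mul_mulVec,
    sqNorm]

theorem d_form (hK : D.K.PosSemidef) (ν : ℝ) (a z : Fin m → ℝ) :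
    a ⬝ᵥ D.d ν z = ν * ((D.Ks *ᵥ a) ⬝ᵥ D.y) +
      1 / 4 * ((D.Kst *ᵥ a) ⬝ᵥ (D.N *ᵥ (D.Kst *ᵥ z))) := by
  have h : a ⬝ᵥ (D.Ks *ᵥ D.y) = (D.Ks *ᵥ a) ⬝ᵥ D.y := by
    rw [dotProduct_mulVec, ← mulVec_transpose, Ks_transpose hK]
  simp only [d, dotProduct_add, dotProduct_smul, smul_eq_mul, Ktilde_form, h]

/-- Consequence of `N ≤ 1`. It forces the kernel of `B ν` into that of `K_st`, so the choice of
solution of `B a = d` does not affect `K_st a`. -/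
theorem B_form_ge (hK : D.K.PosSemidef) (hlam : 0 ≤ D.lam) {ν : ℝ} (hν : 0 ≤ ν) (a : Fin m → ℝ) :
    1 / 4 * sqNorm (D.Kst *ᵥ a) ≤ a ⬝ᵥ (D.B ν *ᵥ a) := by
  rw [B_form hK]
  have h1 := mul_nonneg hν (sqNorm_nonneg (D.Ks *ᵥ a))
  have h2 := N_le hK hlam (D.Kst *ᵥ a)
  linarith

theorem B_posSemidef (hK : D.K.PosSemidef) (hlam : 0 ≤ D.lam) {ν : ℝ} (hν : 0 ≤ ν) :
    (D.B ν).PosSemidef := by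
  refine posSemidef_of_nonneg ?_ fun a => ?_
  · have h : D.Ktilde = D.Kstᵀ * D.N * D.Kst := by simp only [Ktilde, N, Matrix.mul_assoc]
    simp [B, h, Ks_transpose hK, N_transpose hK hlam, Matrix.mul_assoc]
  · have h1 := B_form_ge hK hlam hν a
    have h2 := sqNorm_nonneg (D.Kst *ᵥ a)
    linarith

/-! ### Compactness, convexity and attainment of the inner extrema -/

theorem isCompact_Ks_image_ball (D : Data X m n) : IsCompact ((D.Ks *ᵥ ·) '' D.ball) := by
  have h : (D.Ks *ᵥ ·) '' D.ball =
      (LinearMap.range D.Ks.mulVecLin : Set (Fin m → ℝ)) ∩ {w | sqNorm (w - D.y) ≤ D.r ^ 2} := by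
    ext w
    constructor
    · rintro ⟨a, ha, rfl⟩
      exact ⟨⟨a, rfl⟩, ha⟩
    · rintro ⟨⟨a, rfl⟩, ha⟩
      exact ⟨a, ha, rfl⟩
  rw [h]
  refine ((ProperSpace.isCompact_closedBall D.y |D.r|).of_isClosed_subset
    (isClosed_le (continuous_sqNorm.comp (by fun_prop)) continuous_const) ?_).inter_left
    (Submodule.closed_of_finiteDimensional _)
  intro w hw
  rw [Metric.mem_closedBall, dist_pi_le_iff (abs_nonneg _)]
  exact fun i => sq_le_sq.mp ((sq_le_sqNorm (w - D.y) i).trans hw)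

/-- The ball may be unbounded along the kernel of `K_s`, but `K_st` factors through `K_s`. -/
theorem isCompact_Kst_image_ball (hK : D.K.PosSemidef) : IsCompact ((D.Kst *ᵥ ·) '' D.ball) := by
  have h := (isCompact_Ks_image_ball D).image (f := ((D.Kst * pinv D.Ks) *ᵥ ·)) (by fun_prop)
  simpa only [Set.image_image, mulVec_mulVec, Kst_factor hK] using h

theorem convexOn_residual (D : Data X m n) :
    ConvexOn ℝ Set.univ fun a => sqNorm (D.Ks *ᵥ a - D.y) := by
  refine ⟨convex_univ, fun v _ w _ a b ha hb hab => ?_⟩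
  have h1 : D.Ks *ᵥ (a • v + b • w) - D.y = a • (D.Ks *ᵥ v - D.y) + b • (D.Ks *ᵥ w - D.y) := by
    conv_lhs => rw [← one_smul ℝ D.y, ← hab]
    simp only [mulVec_add, mulVec_smul]
    module
  have h2 := quadForm_convexComb (N := 1) transpose_one hab (D.Ks *ᵥ v - D.y) (D.Ks *ᵥ w - D.y)
  have h3 := mul_nonneg (mul_nonneg ha hb) (sqNorm_nonneg (D.Ks *ᵥ v - D.y - (D.Ks *ᵥ w - D.y)))
  simp only [one_mulVec, ← sqNorm.eq_1] at h2
  simp only [h1, h2, smul_eq_mul]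
  linarith

theorem convex_ball (D : Data X m n) : Convex ℝ D.ball := by
  simpa [ball] using (convexOn_residual D).convex_le (D.r ^ 2)

theorem convex_Kst_image_ball (D : Data X m n) : Convex ℝ ((D.Kst *ᵥ ·) '' D.ball) :=
  (convex_ball D).linear_image D.Kst.mulVecLin

theorem exists_isMaxOn_targetLoss (hK : D.K.PosSemidef) (hne : D.ball.Nonempty) (b : Fin n → ℝ) :
    ∃ a ∈ D.ball, IsMaxOn (D.targetLoss b) D.ball a := by
  obtain ⟨_, ⟨a, ha, rfl⟩, h⟩ := (isCompact_Kst_image_ball hK).exists_isMaxOn (hne.image _)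
    (f := fun s => sqNorm (s - D.Kt *ᵥ b)) (continuous_sqNorm.comp (by fun_prop)).continuousOn
  exact ⟨a, ha, fun a' ha' => h ⟨a', ha', rfl⟩⟩

theorem exists_isMinOn_targetLoss (hK : D.K.PosSemidef) (hne : D.ball.Nonempty) (b : Fin n → ℝ) :
    ∃ a ∈ D.ball, IsMinOn (D.targetLoss b) D.ball a := by
  obtain ⟨_, ⟨a, ha, rfl⟩, h⟩ := (isCompact_Kst_image_ball hK).exists_isMinOn (hne.image _)
    (f := fun s => sqNorm (s - D.Kt *ᵥ b)) (continuous_sqNorm.comp (by fun_prop)).continuousOn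
  exact ⟨a, ha, fun a' ha' => h ⟨a', ha', rfl⟩⟩

theorem objective_eq {b : Fin n → ℝ} {a₁ a₀ : Fin m → ℝ} (h₁ : a₁ ∈ D.ball)
    (hmax : IsMaxOn (D.targetLoss b) D.ball a₁) (h₀ : a₀ ∈ D.ball)
    (hmin : IsMinOn (D.targetLoss b) D.ball a₀) :
    D.objective b = D.lam * (b ⬝ᵥ (D.Kt *ᵥ b)) +
      (1 / 2) * (D.targetLoss b a₁ + D.targetLoss b a₀) := by
  have h1 : IsGreatest (D.targetLoss b '' D.ball) (D.targetLoss b a₁) :=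
    ⟨⟨a₁, h₁, rfl⟩, by rintro _ ⟨a, ha, rfl⟩; exact hmax ha⟩
  have h2 : IsLeast (D.targetLoss b '' D.ball) (D.targetLoss b a₀) :=
    ⟨⟨a₀, h₀, rfl⟩, by rintro _ ⟨a, ha, rfl⟩; exact hmin ha⟩
  rw [objective, h1.csSup_eq, h2.csInf_eq]

theorem targetLoss_eq (D : Data X m n) (b : Fin n → ℝ) (a : Fin m → ℝ) : D.targetLoss b a =
    sqNorm (D.Kst *ᵥ a) - 2 * ((D.Kst *ᵥ a) ⬝ᵥ (D.Kt *ᵥ b)) + sqNorm (D.Kt *ᵥ b) :=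
  sqNorm_sub _ _

/-! ### Tightness of the moment relaxation -/

/-- Moving along `v` to the boundary of an enlarged ball, one gains at least the energy of `v`. -/
theorem exists_step (hK : D.K.PosSemidef) (b : Fin n → ℝ) (z v : Fin m → ℝ) :
    ∃ t : ℝ, sqNorm (D.Ks *ᵥ (z + t • v) - D.y) = sqNorm (D.Ks *ᵥ z - D.y) + sqNorm (D.Ks *ᵥ v) ∧
      D.targetLoss b z + sqNorm (D.Kst *ᵥ v) ≤ D.targetLoss b (z + t • v) := by
  by_cases hv : D.Ks *ᵥ v = 0
  · exact ⟨0, by simp [hv], by simp [Kst_mulVec_eq_zero hK hv]⟩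
  have hc : ∀ t : ℝ, sqNorm (D.Ks *ᵥ (z + t • v) - D.y) = sqNorm (D.Ks *ᵥ z - D.y) +
      2 * t * ((D.Ks *ᵥ z - D.y) ⬝ᵥ (D.Ks *ᵥ v)) + t ^ 2 * sqNorm (D.Ks *ᵥ v) := fun t => by
    rw [mulVec_add, mulVec_smul, add_sub_right_comm, sqNorm_add, sqNorm_smul, dotProduct_smul,
      smul_eq_mul]
    ring
  have hl : ∀ t : ℝ, D.targetLoss b (z + t • v) = D.targetLoss b z +
      2 * t * ((D.Kst *ᵥ z - D.Kt *ᵥ b) ⬝ᵥ (D.Kst *ᵥ v)) + t ^ 2 * sqNorm (D.Kst *ᵥ v) :=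
    fun t => by
    rw [targetLoss, mulVec_add, mulVec_smul, add_sub_right_comm, sqNorm_add, sqNorm_smul,
      dotProduct_smul, smul_eq_mul, targetLoss]
    ring
  simp only [hc, hl]
  have hP : 0 < sqNorm (D.Ks *ᵥ v) :=
    lt_of_le_of_ne (sqNorm_nonneg _) fun h => hv (sqNorm_eq_zero.mp h.symm)
  generalize sqNorm (D.Ks *ᵥ v) = P at hP
  generalize (D.Ks *ᵥ z - D.y) ⬝ᵥ (D.Ks *ᵥ v) = q
  generalize (D.Kst *ᵥ z - D.Kt *ᵥ b) ⬝ᵥ (D.Kst *ᵥ v) = e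
  generalize sqNorm (D.Kst *ᵥ v) = E
  generalize sqNorm (D.Ks *ᵥ z - D.y) = c
  generalize D.targetLoss b z = l
  -- The equation `P t² + 2 q t = P` has roots with product `-1`, so `-t⁻¹` is the other root.
  obtain ⟨t, ht0, ht⟩ : ∃ t : ℝ, t ≠ 0 ∧ 2 * t * q + t ^ 2 * P = P := by
    have hs : √(q ^ 2 + P ^ 2) ^ 2 = q ^ 2 + P ^ 2 := Real.sq_sqrt (by positivity)
    have hroot : 2 * ((√(q ^ 2 + P ^ 2) - q) / P) * q +
        ((√(q ^ 2 + P ^ 2) - q) / P) ^ 2 * P = P := by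
      field_simp
      linear_combination hs
    refine ⟨_, fun h => ?_, hroot⟩
    rw [h] at hroot
    simp at hroot
    exact hP.ne hroot
  -- The excess `2 t e + t² E - E` at `-t⁻¹` is `-t⁻²` times the excess at `t`, so one of the two
  -- roots is good.
  rcases le_total E (2 * t * e + t ^ 2 * E) with h | h
  · exact ⟨t, by linarith, by linarith⟩
  · refine ⟨-t⁻¹, ?_, ?_⟩
    · field_simp
      linear_combination -ht
    · have h1 := mul_nonneg (sq_nonneg t⁻¹) (sub_nonneg.mpr h)
      have h2 : t⁻¹ ^ 2 * (E - (2 * t * e + t ^ 2 * E)) = t⁻¹ ^ 2 * E - 2 * t⁻¹ * e - E := by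
        field_simp
        ring
      rw [h2] at h1
      linarith

theorem exists_absorb (hK : D.K.PosSemidef) (b : Fin n → ℝ) {ι : Type*} (s : Finset ι)
    (V : ι → Fin m → ℝ) (z : Fin m → ℝ) :
    ∃ a, sqNorm (D.Ks *ᵥ a - D.y) =
        sqNorm (D.Ks *ᵥ z - D.y) + ∑ i ∈ s, sqNorm (D.Ks *ᵥ V i) ∧
      D.targetLoss b z + ∑ i ∈ s, sqNorm (D.Kst *ᵥ V i) ≤ D.targetLoss b a := by
  classical
  induction s using Finset.induction_on generalizing z with
  | empty => exact ⟨z, by simp, by simp⟩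
  | insert i s hi ih =>
    obtain ⟨t, h1, h2⟩ := exists_step hK b z (V i)
    obtain ⟨a, h3, h4⟩ := ih (z + t • V i)
    refine ⟨a, ?_, ?_⟩ <;> rw [Finset.sum_insert hi]
    · rw [h3, h1, add_assoc]
    · linarith

/-- The moment relaxation of the inner maximization is tight. -/
theorem exists_mem_ball_of_moments (hK : D.K.PosSemidef) {Z : Matrix (Fin m) (Fin m) ℝ}
    {z : Fin m → ℝ} (hZ : (bordered Z z 1).PosSemidef)
    (htr : (D.Ks * D.Ks * Z).trace - 2 * (D.y ⬝ᵥ (D.Ks *ᵥ z)) + sqNorm D.y ≤ D.r ^ 2)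
    (b : Fin n → ℝ) :
    ∃ a ∈ D.ball, (D.Kstᵀ * D.Kst * Z).trace - 2 * ((D.Kst *ᵥ z) ⬝ᵥ (D.Kt *ᵥ b)) +
      sqNorm (D.Kt *ᵥ b) ≤ D.targetLoss b a := by
  obtain ⟨V, rfl⟩ := exists_deviations hZ
  obtain ⟨a, h1, h2⟩ := exists_absorb hK b Finset.univ V z
  simp only [Ks_mul_Ks hK, Matrix.mul_add, Matrix.mul_sum, trace_add, trace_sum,
    trace_transpose_mul_vecMulVec] at htr ⊢
  refine ⟨a, ?_, ?_⟩
  · rw [sqNorm_sub (D.Ks *ᵥ z), dotProduct_comm (D.Ks *ᵥ z)] at h1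
    rw [ball, Set.mem_ofPred_eq, h1]
    linarith
  · rw [targetLoss_eq] at h2
    linarith

/-! ### Weak duality and recovery of a solution -/

/-- The duality gap dominates the two completed squares. -/
theorem squares_le_gap (hK : D.K.PosSemidef) (hlam : 0 ≤ D.lam) (hne : D.ball.Nonempty)
    {p : SDPVar m} (hp : D.SDPFeasible p) {b : Fin n → ℝ} {a : Fin m → ℝ} (ha : a ∈ D.ball)
    (hmin : IsMinOn (D.targetLoss b) D.ball a) :
    (b - (1 / 2 : ℝ) • D.ridge (D.Kst *ᵥ (a + p.z))) ⬝ᵥ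
        (D.M *ᵥ (b - (1 / 2 : ℝ) • D.ridge (D.Kst *ᵥ (a + p.z)))) +
      (a ⬝ᵥ (D.B p.ν *ᵥ a) - 2 * (a ⬝ᵥ D.d p.ν p.z) + (p.α + p.ν * (sqNorm D.y - D.r ^ 2))) ≤
      D.objective b - D.sdpObjective p := by
  obtain ⟨a₁, h₁, hmax⟩ := exists_isMaxOn_targetLoss hK hne b
  obtain ⟨a₂, h₂, hm⟩ := exists_mem_ball_of_moments hK hp.psd_moment hp.trace_le b
  have hm1 : D.targetLoss b a₂ ≤ D.targetLoss b a₁ := hmax h₂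
  -- This test vector minimizes the bordered form and yields `β ≥ ¼ zᵀ K̃ z`.
  have hβ := nonneg_of_bordered hp.psd_beta 1 (-((1 / 2 : ℝ) • D.ridge (D.Kst *ᵥ p.z)))
  have hβ' : D.ridge (D.Kst *ᵥ p.z) ⬝ᵥ (D.Kt *ᵥ (D.Kst *ᵥ p.z)) =
      (D.Kst *ᵥ p.z) ⬝ᵥ (D.N *ᵥ (D.Kst *ᵥ p.z)) := by
    rw [← M_ridge hK hlam, ridge_form hK hlam]
  simp only [mulVec_neg, mulVec_smul, neg_dotProduct, dotProduct_neg, ridge_form hK hlam,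
    dotProduct_smul, smul_dotProduct, smul_eq_mul, hβ'] at hβ
  have hν := mul_le_mul_of_nonneg_left (show sqNorm (D.Ks *ᵥ a - D.y) ≤ D.r ^ 2 from ha)
    hp.nu_nonneg
  rw [sqNorm_sub] at hν
  rw [M_square hK hlam, B_form hK, d_form hK, objective_eq h₁ hmax ha hmin,
    M_form hK, sdpObjective, targetLoss_eq D b a, mulVec_add,
    quadForm_add (N_transpose hK hlam), add_dotProduct]
  linarith

theorem dual_slack_nonneg {p : SDPVar m} (hp : D.SDPFeasible p) (a : Fin m → ℝ) :
    0 ≤ a ⬝ᵥ (D.B p.ν *ᵥ a) - 2 * (a ⬝ᵥ D.d p.ν p.z) + (p.α + p.ν * (sqNorm D.y - D.r ^ 2)) := by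
  have h := nonneg_of_bordered hp.psd_dual (-1) a
  linarith

/-- Weak duality. -/
theorem sdpObjective_le_objective (hK : D.K.PosSemidef) (hlam : 0 ≤ D.lam)
    (hne : D.ball.Nonempty) {p : SDPVar m} (hp : D.SDPFeasible p) (b : Fin n → ℝ) :
    D.sdpObjective p ≤ D.objective b := by
  obtain ⟨a, ha, hmin⟩ := exists_isMinOn_targetLoss hK hne b
  have h1 := squares_le_gap hK hlam hne hp ha hmin
  have h2 := dual_slack_nonneg hp a
  have h3 := quadForm_nonneg (M_posSemidef hK hlam)
    (b - (1 / 2 : ℝ) • D.ridge (D.Kst *ᵥ (a + p.z)))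
  linarith

/-- Only `K_t b` matters, since `bᵀ K_t b` is also determined by it when `K_t` is symmetric. -/
theorem objective_congr (hK : D.K.PosSemidef) {b b' : Fin n → ℝ} (h : D.Kt *ᵥ b = D.Kt *ᵥ b') :
    D.objective b = D.objective b' := by
  have h1 : D.targetLoss b = D.targetLoss b' := by ext a; rw [targetLoss, h, targetLoss]
  have h2 : b ⬝ᵥ (D.Kt *ᵥ b) = b' ⬝ᵥ (D.Kt *ᵥ b') := by
    rw [h, dotProduct_mulVec_comm (transpose_eq_of_posSemidef (Kt_posSemidef hK)), h]
  rw [objective, objective, h1, h2]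

/-- If `a` minimizes the quadratic of a bordered matrix with value zero, then `A a = v`. -/
theorem _root_.DomainAdaptation.mulVec_eq_of_slack_eq_zero {k : ℕ} {A : Matrix (Fin k) (Fin k) ℝ}
    {v : Fin k → ℝ} {c : ℝ} (hA : Aᵀ = A) (h : (bordered A v c).PosSemidef) {a : Fin k → ℝ}
    (ha : a ⬝ᵥ (A *ᵥ a) - 2 * (a ⬝ᵥ v) + c = 0) : A *ᵥ a = v := by
  have key : ∀ w : Fin k → ℝ, w ⬝ᵥ (v - A *ᵥ a) ≤ 0 := fun w => by
    refine nonpos_of_forall_le_mul (c := 1 / 2 * (w ⬝ᵥ (A *ᵥ w))) fun ε h0 _ => ?_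
    have h1 := nonneg_of_bordered h (-1) (a + ε • w)
    rw [quadForm_add hA, quadForm_smul] at h1
    simp only [add_dotProduct, smul_dotProduct, mulVec_smul, dotProduct_smul, smul_eq_mul,
      dotProduct_mulVec_comm hA a w] at h1
    rw [dotProduct_sub]
    refine le_of_mul_le_mul_left ?_ h0
    linarith
  have h1 := key (v - A *ᵥ a)
  exact (sub_eq_zero.mp (sqNorm_eq_zero.mp (le_antisymm h1 (sqNorm_nonneg _)))).symm

/-- A point of the semidefinite program without duality gap recovers a solution. -/
theorem objective_recover_eq (hK : D.K.PosSemidef) (hlam : 0 ≤ D.lam) (hne : D.ball.Nonempty)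
    {p : SDPVar m} (hp : D.SDPFeasible p) {b : Fin n → ℝ}
    (hb : D.objective b = D.sdpObjective p) : D.objective (D.recover p) = D.objective b := by
  obtain ⟨a, ha, hmin⟩ := exists_isMinOn_targetLoss hK hne b
  have h1 := squares_le_gap hK hlam hne hp ha hmin
  have h2 := dual_slack_nonneg hp a
  have h3 := quadForm_nonneg (M_posSemidef hK hlam)
    (b - (1 / 2 : ℝ) • D.ridge (D.Kst *ᵥ (a + p.z)))
  have hBp := B_posSemidef hK hlam hp.nu_nonneg
  -- With zero gap both squares vanish: one gives the stationarity of `a`, the other fixes `K_t b`.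
  have h4 : D.B p.ν *ᵥ a = D.d p.ν p.z :=
    mulVec_eq_of_slack_eq_zero (transpose_eq_of_posSemidef hBp) hp.psd_dual (by linarith)
  have h5 := Kt_mulVec_eq_zero hK hlam (le_antisymm (by linarith) h3)
  rw [mulVec_sub, sub_eq_zero] at h5
  have h6 : D.B p.ν *ᵥ (pinv (D.B p.ν) *ᵥ D.d p.ν p.z - a) = 0 := by
    rw [← h4, mulVec_sub, mulVec_mulVec, mulVec_mulVec, (pinv_spec _).mul_mul_self, sub_self]
  have h7 := B_form_ge hK hlam hp.nu_nonneg (pinv (D.B p.ν) *ᵥ D.d p.ν p.z - a)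
  rw [h6, dotProduct_zero] at h7
  have h8 := sqNorm_eq_zero.mp (le_antisymm (by linarith) (sqNorm_nonneg
    (D.Kst *ᵥ (pinv (D.B p.ν) *ᵥ D.d p.ν p.z - a))))
  rw [mulVec_sub, sub_eq_zero] at h8
  refine objective_congr hK ?_
  rw [h5, mulVec_add, ← h8, ← mulVec_add]
  rfl

end Data

/-! ### Lagrange multipliers and strong duality -/

/-- Lagrange multiplier for one convex constraint with a strictly feasible point. -/
theorem exists_multiplier {E : Type*} [AddCommGroup E] [Module ℝ E] {g c : E → ℝ}
    (hg : ConvexOn ℝ Set.univ g) (hc : ConvexOn ℝ Set.univ c) {v : ℝ}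
    (hv : ∀ a, c a ≤ 0 → v ≤ g a) (hs : ∃ a, c a < 0) :
    ∃ ν : ℝ, 0 ≤ ν ∧ ∀ a, v ≤ g a + ν * c a := by
  -- Strictly feasible points bound `ν` above by these ratios, infeasible points bound it below; the
  -- infimum of the upper bounds meets both.
  set R := (fun a => (g a - v) / (-c a)) '' {a | c a < 0}
  have hR0 : ∀ x ∈ R, 0 ≤ x := by
    rintro _ ⟨a, ha, rfl⟩
    exact div_nonneg (sub_nonneg.mpr (hv a (le_of_lt ha))) (neg_nonneg.mpr (le_of_lt ha))
  have hRne : R.Nonempty := by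
    obtain ⟨a, ha⟩ := hs
    exact ⟨_, a, ha, rfl⟩
  refine ⟨sInf R, le_csInf hRne hR0, fun a => ?_⟩
  rcases lt_trichotomy (c a) 0 with h | h | h
  · have h1 : sInf R ≤ (g a - v) / (-c a) := csInf_le ⟨0, hR0⟩ ⟨a, h, rfl⟩
    rw [le_div_iff₀ (neg_pos.mpr h)] at h1
    linarith
  · rw [h, mul_zero, add_zero]
    exact hv a h.le
  · have h1 : (v - g a) / c a ≤ sInf R := by
      refine le_csInf hRne ?_
      rintro _ ⟨a', ha' : c a' < 0, rfl⟩
      rw [div_le_div_iff₀ h (neg_pos.mpr ha')]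
      have hd : 0 < c a - c a' := by linarith
      have hw : c a / (c a - c a') + -c a' / (c a - c a') = 1 := by field_simp; ring
      have hw0 : 0 ≤ c a / (c a - c a') := (div_pos h hd).le
      have hw1 : 0 ≤ -c a' / (c a - c a') := (div_pos (neg_pos.mpr ha') hd).le
      have h2 := hc.2 (Set.mem_univ a') (Set.mem_univ a) hw0 hw1 hw
      have h3 := hg.2 (Set.mem_univ a') (Set.mem_univ a) hw0 hw1 hw
      simp only [smul_eq_mul] at h2 h3
      have h4 : c a / (c a - c a') * c a' + -c a' / (c a - c a') * c a = 0 := by field_simp; ring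
      have h5 := mul_le_mul_of_nonneg_left ((hv _ (h2.trans_eq h4)).trans h3) hd.le
      have h6 : (c a - c a') * (c a / (c a - c a') * g a' + -c a' / (c a - c a') * g a) =
          c a * g a' - c a' * g a := by field_simp; ring
      rw [h6] at h5
      linarith
    rw [div_le_iff₀ h] at h1
    linarith

namespace Data

variable {X : Type*} {m n : ℕ} {D : Data X m n}

theorem posSemidef_bordered_vecMulVec {k : ℕ} (a : Fin k → ℝ) :
    (bordered (vecMulVec a a) a 1).PosSemidef := by
  have h : (vecMulVec a a).PosSemidef := by simpa using posSemidef_vecMulVec_self_star a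
  refine bordered_posSemidef h fun b => ?_
  rw [vecMulVec_mulVec, op_smul_eq_smul, dotProduct_smul, smul_eq_mul, dotProduct_comm a b]
  linarith [sq_nonneg (b ⬝ᵥ a + 1)]

theorem bordered_convexComb {k : ℕ} (Z W : Matrix (Fin k) (Fin k) ℝ) (z w : Fin k → ℝ) {a b : ℝ}
    (hab : a + b = 1) : bordered (a • Z + b • W) (a • z + b • w) 1 =
      a • bordered Z z 1 + b • bordered W w 1 := by
  ext (i | i) (j | j) <;> simp [bordered, hab]

/-- Every mixture of points of the ball has moments in the feasible set of the relaxation. -/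
theorem exists_moments (hK : D.K.PosSemidef) {p : ℝ × (Fin n → ℝ)}
    (hp : p ∈ convexHull ℝ
      ((fun s : Fin n → ℝ => (1 / 2 * sqNorm s, s)) '' ((D.Kst *ᵥ ·) '' D.ball))) :
    ∃ (Z : Matrix (Fin m) (Fin m) ℝ) (z : Fin m → ℝ), (bordered Z z 1).PosSemidef ∧
      (D.Ks * D.Ks * Z).trace - 2 * (D.y ⬝ᵥ (D.Ks *ᵥ z)) + sqNorm D.y ≤ D.r ^ 2 ∧
      p = (1 / 2 * (D.Kstᵀ * D.Kst * Z).trace, D.Kst *ᵥ z) := by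
  refine convexHull_min (t := {p : ℝ × (Fin n → ℝ) | ∃ (Z : Matrix (Fin m) (Fin m) ℝ)
    (z : Fin m → ℝ), (bordered Z z 1).PosSemidef ∧
      (D.Ks * D.Ks * Z).trace - 2 * (D.y ⬝ᵥ (D.Ks *ᵥ z)) + sqNorm D.y ≤ D.r ^ 2 ∧
      p = (1 / 2 * (D.Kstᵀ * D.Kst * Z).trace, D.Kst *ᵥ z)}) ?_ ?_ hp
  · rintro _ ⟨_, ⟨a, ha, rfl⟩, rfl⟩
    refine ⟨vecMulVec a a, a, posSemidef_bordered_vecMulVec a, ?_, ?_⟩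
    · rw [ball, Set.mem_ofPred_eq, sqNorm_sub] at ha
      rwa [Ks_mul_Ks hK, trace_transpose_mul_vecMulVec, dotProduct_comm D.y]
    · rw [trace_transpose_mul_vecMulVec]
  · rintro _ ⟨Z, z, hZ, htr, rfl⟩ _ ⟨W, w, hW, htr', rfl⟩ a b ha hb hab
    refine ⟨a • Z + b • W, a • z + b • w, ?_, ?_, ?_⟩
    · rw [bordered_convexComb Z W z w hab]
      exact (hZ.smul ha).add (hW.smul hb)
    · have h1 := mul_le_mul_of_nonneg_left htr ha
      have h2 := mul_le_mul_of_nonneg_left htr' hb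
      simp only [Matrix.mul_add, Matrix.mul_smul, trace_add, trace_smul, mulVec_add, mulVec_smul,
        dotProduct_add, dotProduct_smul, smul_eq_mul]
      obtain rfl : b = 1 - a := by linarith
      linarith
    · ext i
      · simp only [Matrix.mul_add, Matrix.mul_smul, trace_add, trace_smul, smul_eq_mul,
          Prod.fst_add, Prod.smul_fst]
        ring
      · simp [mulVec_add, mulVec_smul]

/-- A lower bound of the Lagrangian yields a feasible point of the semidefinite program. -/
theorem exists_feasible (hK : D.K.PosSemidef) (hlam : 0 ≤ D.lam) {Z : Matrix (Fin m) (Fin m) ℝ}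
    {z : Fin m → ℝ} (hZ : (bordered Z z 1).PosSemidef)
    (htr : (D.Ks * D.Ks * Z).trace - 2 * (D.y ⬝ᵥ (D.Ks *ᵥ z)) + sqNorm D.y ≤ D.r ^ 2)
    {ν γ : ℝ} (hν : 0 ≤ ν)
    (h : ∀ a, γ ≤ payoff D.N (D.Kst *ᵥ a) (1 / 2 * (D.Kstᵀ * D.Kst * Z).trace, D.Kst *ᵥ z) +
      ν * (sqNorm (D.Ks *ᵥ a - D.y) - D.r ^ 2)) :
    ∃ p, D.SDPFeasible p ∧ D.sdpObjective p = γ := by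
  set q := 1 / 4 * ((D.Kst *ᵥ z) ⬝ᵥ (D.N *ᵥ (D.Kst *ᵥ z))) with hq
  -- `β = q` is the least value its block allows; `α` is then forced by the objective value `γ`.
  refine ⟨⟨1 / 2 * (D.Kstᵀ * D.Kst * Z).trace - q - γ, q, ν, Z, z⟩, ⟨?_, hZ, ?_, htr, hν⟩, ?_⟩
  · refine bordered_posSemidef (B_posSemidef hK hlam hν) fun a => ?_
    have h1 := h (-a)
    rw [payoff, quadForm_add (N_transpose hK hlam), sqNorm_sub] at h1
    rw [B_form hK, d_form hK]
    simp only [mulVec_neg, neg_dotProduct, dotProduct_neg, neg_neg, sqNorm] at h1 ⊢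
    linarith
  · refine bordered_posSemidef (M_posSemidef hK hlam) fun b => ?_
    have h1 := quadForm_nonneg (M_posSemidef hK hlam)
      (-b - (1 / 2 : ℝ) • D.ridge (D.Kst *ᵥ z))
    rw [M_square hK hlam] at h1
    simp only [mulVec_neg, neg_dotProduct, dotProduct_neg, neg_neg] at h1
    rw [dotProduct_smul, smul_eq_mul,
      dotProduct_mulVec_comm (transpose_eq_of_posSemidef (Kt_posSemidef hK))]
    linarith
  · simp only [sdpObjective]
    ring

/-- Lagrangian duality for the inner minimization when the ball has a strictly feasible point. -/
theorem exists_multiplier_payoff (hK : D.K.PosSemidef) (hlam : 0 ≤ D.lam)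
    (hs : ∃ a, sqNorm (D.Ks *ᵥ a - D.y) < D.r ^ 2) {p : ℝ × (Fin n → ℝ)} {v : ℝ}
    (hv : ∀ a ∈ D.ball, v ≤ payoff D.N (D.Kst *ᵥ a) p) :
    ∃ ν : ℝ, 0 ≤ ν ∧ ∀ a, v ≤ payoff D.N (D.Kst *ᵥ a) p +
      ν * (sqNorm (D.Ks *ᵥ a - D.y) - D.r ^ 2) := by
  refine exists_multiplier (g := fun a => payoff D.N (D.Kst *ᵥ a) p)
    (c := fun a => sqNorm (D.Ks *ᵥ a - D.y) - D.r ^ 2) ?_ ?_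
    (fun a ha => hv a (sub_nonpos.mp ha)) ?_
  · exact (convexOn_payoff (N_transpose hK hlam) (N_le hK hlam) convex_univ p).comp_linearMap
      D.Kst.mulVecLin
  · exact (convexOn_residual D).sub (concaveOn_const _ convex_univ)
  · obtain ⟨a, ha⟩ := hs
    exact ⟨a, sub_neg.mpr ha⟩

/-- Without a strictly feasible point, a large multiplier still loses arbitrarily little. -/
theorem exists_approx_multiplier_payoff (hK : D.K.PosSemidef) (hlam : 0 ≤ D.lam)
    (hs : ∀ a, D.r ^ 2 ≤ sqNorm (D.Ks *ᵥ a - D.y)) (p : ℝ × (Fin n → ℝ)) {a₀ : Fin m → ℝ}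
    (ha₀ : a₀ ∈ D.ball) {ε : ℝ} (hε : 0 < ε) :
    ∃ ν : ℝ, 0 ≤ ν ∧ ∀ a, payoff D.N (D.Kst *ᵥ a₀) p - ε ≤ payoff D.N (D.Kst *ᵥ a) p +
      ν * (sqNorm (D.Ks *ᵥ a - D.y) - D.r ^ 2) := by
  have hres : ∀ w, sqNorm (D.Ks *ᵥ (a₀ + w) - D.y) = sqNorm (D.Ks *ᵥ a₀ - D.y) +
      2 * ((D.Ks *ᵥ a₀ - D.y) ⬝ᵥ (D.Ks *ᵥ w)) + sqNorm (D.Ks *ᵥ w) := fun w => by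
    rw [mulVec_add, add_sub_right_comm, sqNorm_add]
  have ha₀' : sqNorm (D.Ks *ᵥ a₀ - D.y) ≤ D.r ^ 2 := ha₀
  -- Every point of the ball now minimizes the residual, so moving by `w` raises it by at least
  -- `|K_s w|²`.
  have horth : ∀ w, 0 ≤ (D.Ks *ᵥ a₀ - D.y) ⬝ᵥ (D.Ks *ᵥ w) := fun w => by
    refine neg_nonpos.mp (nonpos_of_forall_le_mul (c := 1 / 2 * sqNorm (D.Ks *ᵥ w))
      fun t h0 _ => ?_)
    have h1 := hs (a₀ + t • w)
    rw [hres, mulVec_smul, dotProduct_smul, sqNorm_smul, smul_eq_mul] at h1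
    refine le_of_mul_le_mul_left ?_ h0
    linarith
  -- Gradient of the payoff at `a₀`, expressed as a functional of `K_s w`.
  set f := (D.Kst * pinv D.Ks)ᵀ *ᵥ
    (D.Kst *ᵥ a₀ - (1 / 2 : ℝ) • (D.N *ᵥ (D.Kst *ᵥ a₀ + p.2))) with hf
  have hF := sqNorm_nonneg f
  -- A linear term `fᵀ x` plus `ν |x|²` is at least `-|f|² / (4 ν)`, here at least `-ε`; the `+ 1`
  -- keeps `ν` positive when `f = 0`.
  have hν : 0 < (sqNorm f + 1) / (4 * ε) := by positivity
  refine ⟨(sqNorm f + 1) / (4 * ε), hν.le, fun a => ?_⟩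
  set ν := (sqNorm f + 1) / (4 * ε) with hνdef
  obtain ⟨w, rfl⟩ : ∃ w, a = a₀ + w := ⟨a - a₀, by abel⟩
  have hfw : f ⬝ᵥ (D.Ks *ᵥ w) = (D.Kst *ᵥ a₀) ⬝ᵥ (D.Kst *ᵥ w) -
      1 / 2 * ((D.Kst *ᵥ a₀ + p.2) ⬝ᵥ (D.N *ᵥ (D.Kst *ᵥ w))) := by
    rw [hf, mulVec_transpose, ← dotProduct_mulVec, mulVec_mulVec, Kst_factor hK, sub_dotProduct,
      smul_dotProduct, smul_eq_mul, dotProduct_comm (D.N *ᵥ _),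
      dotProduct_mulVec_comm (N_transpose hK hlam)]
  have hpay : payoff D.N (D.Kst *ᵥ (a₀ + w)) p = payoff D.N (D.Kst *ᵥ a₀) p +
      f ⬝ᵥ (D.Ks *ᵥ w) + (1 / 2 * sqNorm (D.Kst *ᵥ w) -
        1 / 4 * ((D.Kst *ᵥ w) ⬝ᵥ (D.N *ᵥ (D.Kst *ᵥ w)))) := by
    rw [hfw, payoff, payoff, mulVec_add, add_right_comm, quadForm_add (N_transpose hK hlam),
      sqNorm_add]
    ring
  have h1 := N_le hK hlam (D.Kst *ᵥ w)
  have h2 := sqNorm_nonneg (D.Kst *ᵥ w)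
  have h3 := horth w
  have h4 := hs a₀
  have h5 := sqNorm_nonneg (f + (2 * ν) • (D.Ks *ᵥ w))
  rw [sqNorm_add, sqNorm_smul, dotProduct_smul, smul_eq_mul] at h5
  have h6 : sqNorm f ≤ 4 * ν * ε := by
    have : 4 * ν * ε = sqNorm f + 1 := by rw [hνdef]; field_simp
    linarith
  have h7 : 0 ≤ ε + f ⬝ᵥ (D.Ks *ᵥ w) + ν * sqNorm (D.Ks *ᵥ w) := by
    refine nonneg_of_mul_nonneg_right (a := 4 * ν) ?_ (by positivity)
    linarith
  have h8 : ν * sqNorm (D.Ks *ᵥ w) ≤ ν * (sqNorm (D.Ks *ᵥ (a₀ + w) - D.y) - D.r ^ 2) := by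
    refine mul_le_mul_of_nonneg_left ?_ hν.le
    rw [hres]
    linarith
  rw [hpay]
  linarith

/-- The hypothesis built from a saddle point attains the saddle value. -/
theorem objective_le_payoff (hK : D.K.PosSemidef) (hlam : 0 ≤ D.lam) (hne : D.ball.Nonempty)
    {a₀ : Fin m → ℝ} (ha₀ : a₀ ∈ D.ball) {p : ℝ × (Fin n → ℝ)}
    (h : ∀ t ∈ (D.Kst *ᵥ ·) '' D.ball,
      1 / 2 * sqNorm t - 1 / 2 * ((D.Kst *ᵥ a₀ + p.2) ⬝ᵥ (D.N *ᵥ t)) ≤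
        p.1 - 1 / 2 * ((D.Kst *ᵥ a₀ + p.2) ⬝ᵥ (D.N *ᵥ p.2))) :
    D.objective ((1 / 2 : ℝ) • D.ridge (D.Kst *ᵥ a₀ + p.2)) ≤ payoff D.N (D.Kst *ᵥ a₀) p := by
  set w := D.Kst *ᵥ a₀ + p.2 with hw
  set b := (1 / 2 : ℝ) • D.ridge w with hb
  obtain ⟨a₁, h₁, hmax⟩ := exists_isMaxOn_targetLoss hK hne b
  obtain ⟨a₂, h₂, hmin⟩ := exists_isMinOn_targetLoss hK hne b
  have hm : D.targetLoss b a₂ ≤ D.targetLoss b a₀ := hmin ha₀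
  have hN := N_transpose hK hlam
  have hKb : D.Kt *ᵥ b = (1 / 2 : ℝ) • (D.N *ᵥ w) := by rw [hb, mulVec_smul, Kt_ridge]
  have hdot : ∀ s, s ⬝ᵥ (D.Kt *ᵥ b) = 1 / 2 * (w ⬝ᵥ (D.N *ᵥ s)) := fun s => by
    rw [hKb, dotProduct_smul, smul_eq_mul, dotProduct_mulVec_comm hN]
  -- At the chosen `b` the completed square is zero, which evaluates the regularized quadratic part
  -- of the objective.
  have hsq := M_square hK hlam b w
  rw [← hb, sub_self, zero_dotProduct, M_form hK, hdot w] at hsq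
  have hL := h (D.Kst *ᵥ a₁) ⟨a₁, h₁, rfl⟩
  have hww : w ⬝ᵥ (D.N *ᵥ w) = w ⬝ᵥ (D.N *ᵥ (D.Kst *ᵥ a₀)) + w ⬝ᵥ (D.N *ᵥ p.2) := by
    conv_lhs => rw [hw, mulVec_add, dotProduct_add, ← hw]
  rw [targetLoss_eq, targetLoss_eq, hdot (_ *ᵥ a₂), hdot (_ *ᵥ a₀)] at hm
  rw [objective_eq h₁ hmax h₂ hmin, targetLoss_eq, targetLoss_eq, hdot (_ *ᵥ a₁),
    hdot (_ *ᵥ a₂), payoff, ← hw]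
  linarith

/-- Strong duality. -/
theorem exists_strong_duality (hK : D.K.PosSemidef) (hlam : 0 ≤ D.lam) (hne : D.ball.Nonempty) :
    ∃ (v : ℝ) (b : Fin n → ℝ), D.objective b ≤ v ∧
      (∀ ε > 0, ∃ p, D.SDPFeasible p ∧ D.sdpObjective p = v - ε) ∧
      ((∃ a, sqNorm (D.Ks *ᵥ a - D.y) < D.r ^ 2) →
        ∃ p, D.SDPFeasible p ∧ D.sdpObjective p = v) := by
  obtain ⟨_, ⟨a₀, ha₀, rfl⟩, p, hp, hmin, hfirst⟩ := exists_saddle (N_posSemidef hK hlam)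
    (N_le hK hlam) (convex_Kst_image_ball D) (isCompact_Kst_image_ball hK) (hne.image _)
  obtain ⟨Z, z, hZ, htr, rfl⟩ := exists_moments hK hp
  have hv := fun a ha => hmin (D.Kst *ᵥ a) ⟨a, ha, rfl⟩
  have hslater := fun hs => exists_multiplier_payoff hK hlam hs hv
  -- The common value `v` is the payoff at the saddle point.
  refine ⟨_, _, objective_le_payoff hK hlam hne ha₀ hfirst, fun ε hε => ?_, fun hs => ?_⟩
  · by_cases hs : ∃ a, sqNorm (D.Ks *ᵥ a - D.y) < D.r ^ 2
    · obtain ⟨ν, hν, h⟩ := hslater hs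
      exact exists_feasible hK hlam hZ htr hν fun a => (sub_le_self _ hε.le).trans (h a)
    · push Not at hs
      obtain ⟨ν, hν, h⟩ := exists_approx_multiplier_payoff hK hlam hs _ ha₀ hε
      exact exists_feasible hK hlam hZ htr hν h
  · obtain ⟨ν, hν, h⟩ := hslater hs
    exact exists_feasible hK hlam hZ htr hν h

end Data

end DomainAdaptation

/-! ### Assembly: weak and strong duality combined -/

theorem proposition6 {X : Type*} {m n : ℕ} (D : DomainAdaptation.Data X m n)
    (hK : D.K.PosSemidef) (hq : ∀ i, 0 ≤ D.q i) (hlam : 0 ≤ D.lam)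
    (hne : D.ball.Nonempty) :
    -- the inner maximum and the inner minimum of the min–max problem are attained
    (∀ b : Fin n → ℝ,
      (∃ a ∈ D.ball, IsMaxOn (D.targetLoss b) D.ball a) ∧
      (∃ a ∈ D.ball, IsMinOn (D.targetLoss b) D.ball a)) ∧
    -- the min–max problem has a solution, and its value is the optimal value of the SDP
    (∃ v : ℝ, IsLeast (Set.range D.objective) v ∧
      IsLUB (D.sdpObjective '' {p | D.SDPFeasible p}) v) ∧
    -- the SDP has a solution if the ball has a strictly feasible point
    ((∃ a : Fin m → ℝ,
        DomainAdaptation.sqNorm (D.Ks.mulVec a - D.y) < D.r ^ 2) →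
      ∃ p, D.SDPFeasible p ∧ IsMaxOn D.sdpObjective {p | D.SDPFeasible p} p) ∧
    -- every solution of the SDP yields a solution of the min–max problem
    (∀ p, D.SDPFeasible p → IsMaxOn D.sdpObjective {p | D.SDPFeasible p} p →
      IsMinOn D.objective Set.univ (D.recover p)) := by
  obtain ⟨v, b, hb, happrox, hslater⟩ :=
    DomainAdaptation.Data.exists_strong_duality hK hlam hne
  have hweak := fun p (hp : D.SDPFeasible p) =>
    DomainAdaptation.Data.sdpObjective_le_objective hK hlam hne hp
  have hle : ∀ b', v ≤ D.objective b' := fun b' => le_of_forall_pos_le_add fun ε hε => by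
    obtain ⟨p, hp, hpv⟩ := happrox ε hε
    linarith [hweak p hp b']
  have hbv : D.objective b = v := le_antisymm hb (hle b)
  have hlub : IsLUB (D.sdpObjective '' {p | D.SDPFeasible p}) v := by
    refine ⟨?_, fun w hw => le_of_forall_pos_le_add fun ε hε => ?_⟩
    · rintro _ ⟨p, hp, rfl⟩
      exact (hweak p hp b).trans hb
    · obtain ⟨p, hp, hpv⟩ := happrox ε hε
      linarith [hw ⟨p, hp, rfl⟩]
  refine ⟨fun b => ⟨DomainAdaptation.Data.exists_isMaxOn_targetLoss hK hne b,
    DomainAdaptation.Data.exists_isMinOn_targetLoss hK hne b⟩,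
    ⟨v, ⟨⟨b, hbv⟩, ?_⟩, hlub⟩, fun hs => ?_, fun p hp hmax b' _ => ?_⟩
  · rintro _ ⟨b', rfl⟩
    exact hle b'
  · obtain ⟨p, hp, hpv⟩ := hslater hs
    exact ⟨p, hp, fun p' hp' => (hlub.1 ⟨p', hp', rfl⟩).trans_eq hpv.symm⟩
  · have hpv : D.sdpObjective p = v :=
      by
      have hgr : IsGreatest (D.sdpObjective '' {p | D.SDPFeasible p}) (D.sdpObjective p) :=
        ⟨⟨p, hp, rfl⟩, by rintro _ ⟨p', hp', rfl⟩; exact hmax hp'⟩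
      exact hgr.isLUB.unique hlub
    have h := DomainAdaptation.Data.objective_recover_eq hK hlam hne hp (hbv.trans hpv.symm)
    exact (h.trans hbv).trans_le (hle b')
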